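/- Let $L=\sum_{n\ge 1}10^{-n!}$ be Liouville's number. For integers $k\ge 1$ and $1\le j\le k+1$ and a real number $\zeta$, let $\lambda_{k,j}(\zeta)$ (respectively $\widehat{\lambda}_{k,j}(\zeta)$) denote the supremum in $[-\infty,\infty]$ of all $\eta\in\mathbb{R}$ for which the system $$|x|\le X,\qquad \max_{1\le m\le k}|\zeta^{m}x-y_m|\le X^{-\eta}$$ has at least $j$ linearly independent solutions $(x,y_1,\dots,y_k)\in\mathbb{Z}^{k+1}$ for arbitrarily large real $X$ (respectively for all sufficiently large real $X$). Then for every integer $k\ge 1$, $$\lambda_{k,1}(L)=\infty,\qquad \lambda_{k,j}(L)=\frac{1}{j-1}\quad(2\le j\le k+1),$$ $$\widehat{\lambda}_{k,1}(L)=\frac1k,\qquad \widehat{\lambda}_{k,j}(L)=0\quad(2\le j\le k+1).$$ -/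

import Mathlib

open Filter

noncomputable section

/-- The system `|x| ≤ X`, `max_{1 ≤ m ≤ k} |ζ_m x - y_m| ≤ X ^ (-η)` has (at least) `j` linearly
independent solutions `(x, y_1, …, y_k) ∈ ℤ ^ (k + 1)`. The coordinate `0` of a vector is `x`,
the coordinate `m.succ` is the `y` that belongs to `ζ m`. -/
def HasIndepSolutions {k : ℕ} (ζ : Fin k → ℝ) (j : ℕ) (η X : ℝ) : Prop :=
  ∃ v : Fin j → (Fin (k + 1) → ℤ), LinearIndependent ℤ v ∧
    ∀ i : Fin j, |(v i 0 : ℝ)| ≤ X ∧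
      ∀ m : Fin k, |ζ m * (v i 0 : ℝ) - (v i m.succ : ℝ)| ≤ X ^ (-η)

/-- The approximation constant `λ_{k,j}(ζ_1, …, ζ_k)`: the supremum, in the extended reals, of
the real `η` for which the system has `j` linearly independent solutions for arbitrarily
large `X`. -/
def approxConst {k : ℕ} (ζ : Fin k → ℝ) (j : ℕ) : EReal :=
  sSup ((fun η : ℝ => (η : EReal)) '' {η : ℝ | ∃ᶠ X : ℝ in atTop, HasIndepSolutions ζ j η X})

/-- The uniform constant `\hat λ_{k,j}(ζ_1, …, ζ_k)`: the supremum, in the extended reals, of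
the real `η` for which the system has `j` linearly independent solutions for all sufficiently
large `X`. -/
def uniformApproxConst {k : ℕ} (ζ : Fin k → ℝ) (j : ℕ) : EReal :=
  sSup ((fun η : ℝ => (η : EReal)) '' {η : ℝ | ∀ᶠ X : ℝ in atTop, HasIndepSolutions ζ j η X})

/-- The vector `(ζ, ζ ^ 2, …, ζ ^ k)` of successive powers. -/
def powerVector (k : ℕ) (ζ : ℝ) : Fin k → ℝ := fun m => ζ ^ ((m : ℕ) + 1)

/-- `λ_{k,j}(ζ)` for a real number `ζ`. -/
def powerApproxConst (k j : ℕ) (ζ : ℝ) : EReal := approxConst (powerVector k ζ) j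

/-- `\hat λ_{k,j}(ζ)` for a real number `ζ`. -/
def powerUniformApproxConst (k j : ℕ) (ζ : ℝ) : EReal := uniformApproxConst (powerVector k ζ) j

/-- `L = ∑_{n ≥ 1} 10 ^ (-n!)`. The index is shifted by one; Mathlib's `liouvilleNumber 10`
has the additional term `n = 0`. -/
def liouvilleL : ℝ := ∑' n : ℕ, 1 / (10 : ℝ) ^ (n + 1).factorial

/-- The series that defines `L` converges. -/
theorem hasSum_liouvilleL : HasSum (fun n : ℕ => 1 / (10 : ℝ) ^ (n + 1).factorial) liouvilleL :=
  ((summable_nat_add_iff 1).2 (LiouvilleNumber.summable (by norm_num : (1 : ℝ) < 10))).hasSum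

end

/-! Write `q = 10 ^ n!`, `Q = 10 ^ (n+1)! = q ^ (n+1)`, and `p / q` for the `n`-th partial sum of
`L`.

Ordinary constants. For any `ζ`, `n + 1` independent solutions give a nonzero integer minor of size
`O(X ^ (1 - η n))`, so `η ≤ 1 / n` (`approxConst_succ_le`). Conversely, expand `(p / q + 1 / Q) ^ m`
in powers of `1 / Q`, truncate after each degree `i ≤ n` and clear denominators by `q ^ k * Q ^ i`.
The resulting vectors are independent, bounded by `X = q ^ k * Q ^ n`, with error `O(q ^ k / Q)`;
the exponent tends to `1 / n`, and to `∞` if `n = 0`.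

Uniform constants. Dirichlet and the unit vectors give the lower bounds. For the upper bounds, good
approximations with small `x` are proportional to `(1, p / q, …, (p / q) ^ k)`
(`mul_pow_eq_of_approx`). So no two are independent, and `q ^ k` divides `x` by coprimality, which
excludes nonzero ones with `|x| < q ^ k`. -/

theorem HasIndepSolutions.mono {k : ℕ} {ζ : Fin k → ℝ} {i j : ℕ} {η X : ℝ} (hij : i ≤ j)
    (h : HasIndepSolutions ζ j η X) : HasIndepSolutions ζ i η X := by
  obtain ⟨v, hv, h⟩ := h
  exact ⟨v ∘ Fin.castLE hij, hv.comp _ (Fin.castLE_injective hij), fun a => h _⟩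

theorem approxConst_le {k : ℕ} {ζ : Fin k → ℝ} {j : ℕ} {a : ℝ}
    (h : ∀ η, a < η → ∀ᶠ X in atTop, ¬ HasIndepSolutions ζ j η X) :
    approxConst ζ j ≤ (a : EReal) := by
  refine sSup_le ?_
  rintro _ ⟨η, hη, rfl⟩
  exact EReal.coe_le_coe_iff.2 (not_lt.1 fun hlt => hη (h η hlt))

theorem uniformApproxConst_le {k : ℕ} {ζ : Fin k → ℝ} {j : ℕ} {a : ℝ}
    (h : ∀ η, a < η → ∃ᶠ X in atTop, ¬ HasIndepSolutions ζ j η X) :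
    uniformApproxConst ζ j ≤ (a : EReal) := by
  refine sSup_le ?_
  rintro _ ⟨η, hη, rfl⟩
  exact EReal.coe_le_coe_iff.2 (not_lt.1 fun hlt => h η hlt (by simpa using hη))

theorem le_sSup_coe_image {a : ℝ} {S : Set ℝ} (h : ∀ η, η < a → η ∈ S) :
    (a : EReal) ≤ sSup ((fun η : ℝ => (η : EReal)) '' S) := by
  refine le_of_forall_lt fun c hc => ?_
  obtain ⟨b, hcb, hba⟩ := EReal.lt_iff_exists_real_btwn.1 hc
  exact hcb.trans_le (le_sSup ⟨b, h b (EReal.coe_lt_coe_iff.1 hba), rfl⟩)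

/-! ### Upper bound for the ordinary constants by determinants -/

/-- Linearly independent integer vectors have a nonvanishing maximal minor. -/
theorem exists_det_submatrix_ne_zero {ι : Type} [Fintype ι] {j : ℕ} {v : Fin j → ι → ℤ}
    (hv : LinearIndependent ℤ v) :
    ∃ c : Fin j → ι, (Matrix.of fun a b => v a (c b)).det ≠ 0 := by
  classical
  let A : Matrix (Fin j) ι ℚ := Matrix.of fun a b => (v a b : ℚ)
  have hA : LinearIndependent ℚ A.row := by
    rw [← LinearIndependent.iff_fractionRing ℤ ℚ]
    exact hv.map' ((Int.castAddHom ℚ).toIntLinearMap.compLeft ι) (by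
      rw [LinearMap.ker_eq_bot]
      intro x y hxy
      ext i
      have := congrFun hxy i
      simpa using this)
  -- Row rank equals column rank, so `j` independent columns can be selected.
  have hr : A.rank = j := by simpa using hA.rank_matrix
  obtain ⟨κ, a, ha, hspan, hli⟩ := exists_linearIndependent' ℚ A.col
  have : Finite κ := Finite.of_injective a ha
  have := Fintype.ofFinite κ
  have hcard : Fintype.card κ = j := by
    rw [← finrank_span_eq_card hli, hspan, ← Matrix.rank_eq_finrank_span_cols, hr]
  let e : Fin j ≃ κ := (Fintype.equivFinOfCardEq hcard).symm
  refine ⟨a ∘ e, fun h0 => ?_⟩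
  have hli' : LinearIndependent ℚ (A.submatrix id (a ∘ e)).col := hli.comp e e.injective
  rw [Matrix.linearIndependent_cols_iff_isUnit, Matrix.isUnit_iff_isUnit_det] at hli'
  refine hli'.ne_zero ?_
  have := congrArg (Int.cast : ℤ → ℚ) h0
  rw [Int.cast_det, Int.cast_zero] at this
  exact this

theorem abs_det_le_factorial_mul_prod {n : ℕ} {A : Matrix (Fin n) (Fin n) ℝ} {b : Fin n → ℝ}
    (h : ∀ i c, |A i c| ≤ b i) : |A.det| ≤ n.factorial * ∏ i, b i := by
  rw [Matrix.det_apply]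
  refine (Finset.abs_sum_le_sum_abs _ _).trans ?_
  have : ∀ σ ∈ (Finset.univ : Finset (Equiv.Perm (Fin n))),
      |Equiv.Perm.sign σ • ∏ i, A (σ i) i| ≤ ∏ i, b i := by
    intro σ _
    rw [← Equiv.prod_comp σ b]
    have h1 : |Equiv.Perm.sign σ • ∏ i, A (σ i) i| = |∏ i, A (σ i) i| := by
      rcases Int.units_eq_one_or (Equiv.Perm.sign σ) with h | h <;> simp [h]
    rw [h1, Finset.abs_prod]
    exact Finset.prod_le_prod (fun _ _ => abs_nonneg _) fun i _ => h _ _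
  refine (Finset.sum_le_card_nsmul _ _ _ this).trans ?_
  simp [Fintype.card_perm]

/-- A matrix whose rows are within `δ` of multiples `x i • z` has a determinant of order
`X * δ ^ (n - 1)`. -/
theorem abs_det_le_of_near_rankOne {n : ℕ} {A : Matrix (Fin (n + 1)) (Fin (n + 1)) ℝ}
    {x z : Fin (n + 1) → ℝ} {X Z δ : ℝ} (hX : 1 ≤ X) (hδ : δ ≤ 1)
    (hx : ∀ i, |x i| ≤ X) (hz : ∀ i, |z i| ≤ Z) (h : ∀ i c, |x i * z c - A i c| ≤ δ) :
    |A.det| ≤ (n + 1).factorial * (((Z + 1) * X) * (2 * δ) ^ n) := by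
  obtain ⟨i₀, -, hi₀⟩ := Finset.exists_max_image Finset.univ (fun i => |x i|) Finset.univ_nonempty
  -- Pivoting on the row with largest `|x i|` keeps the multipliers at most 1; subtracting `t i`
  -- times that row cancels the rank-one part of every other row.
  let t : Fin (n + 1) → ℝ := fun i => if i = i₀ then 0 else x i / x i₀
  have ht : ∀ i, |t i| ≤ 1 := by
    intro i
    by_cases hi : i = i₀
    · simp [t, hi]
    · simp only [t, if_neg hi, abs_div]
      exact div_le_one_of_le₀ (hi₀ i (Finset.mem_univ _)) (abs_nonneg _)
  have htx : ∀ i, i ≠ i₀ → t i * x i₀ = x i := by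
    intro i hi
    simp only [t, if_neg hi]
    by_cases h0 : x i₀ = 0
    · have := hi₀ i (Finset.mem_univ _)
      rw [h0, abs_zero] at this
      simp [h0, abs_nonpos_iff.1 this]
    · field_simp
  let B : Matrix (Fin (n + 1)) (Fin (n + 1)) ℝ := fun i c => A i c - t i * A i₀ c
  have ht₀ : t i₀ = 0 := by simp [t]
  have hdet : A.det = B.det := by
    refine Matrix.det_eq_of_forall_row_eq_smul_add_const t i₀ ht₀ fun i c => ?_
    simp [B, ht₀]
  have hB : ∀ i c, |B i c| ≤ if i = i₀ then (Z + 1) * X else 2 * δ := by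
    intro i c
    have e0 := abs_le.1 (h i₀ c)
    by_cases hi : i = i₀
    · subst hi
      simp only [if_true, B, ht₀, zero_mul, sub_zero]
      have h1 : |x i * z c| ≤ X * Z := by
        rw [abs_mul]
        exact mul_le_mul (hx i) (hz c) (abs_nonneg _) (by linarith)
      have h2 := abs_le.1 h1
      rw [abs_le]
      constructor <;> nlinarith
    · rw [if_neg hi]
      have key : B i c = t i * (x i₀ * z c - A i₀ c) - (x i * z c - A i c) := by
        simp only [B]
        rw [← htx i hi]; ring
      rw [key]
      refine (abs_sub _ _).trans ?_
      rw [abs_mul]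
      have := mul_le_mul (ht i) (h i₀ c) (abs_nonneg _) zero_le_one
      linarith [h i c]
  rw [hdet]
  refine (abs_det_le_factorial_mul_prod hB).trans (le_of_eq ?_)
  rw [← Finset.mul_prod_erase _ _ (Finset.mem_univ i₀), if_pos rfl]
  congr 2
  rw [Finset.prod_congr rfl (g := fun _ => 2 * δ)
    (fun i hi => if_neg (Finset.ne_of_mem_erase hi))]
  simp

theorem approxConst_succ_le {k : ℕ} (ζ : Fin k → ℝ) {n : ℕ} (hn : 1 ≤ n) :
    approxConst ζ (n + 1) ≤ ((1 / (n : ℝ) : ℝ) : EReal) := by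
  refine approxConst_le fun η hη => ?_
  have hn0 : (0 : ℝ) < n := by exact_mod_cast hn
  have hη0 : 0 < η := lt_trans (by positivity) hη
  have hηn : 0 < η * n - 1 := by rw [div_lt_iff₀ hn0] at hη; linarith
  -- The prepended 1 makes coordinate `0` a column approximated with no error.
  let z : Fin (k + 1) → ℝ := Fin.cons 1 ζ
  obtain ⟨Z, hZ⟩ : ∃ Z, ∀ i, |z i| ≤ Z := ⟨∑ i, |z i|, fun i =>
    Finset.single_le_sum (f := fun i => |z i|) (fun _ _ => abs_nonneg _) (Finset.mem_univ i)⟩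
  set C : ℝ := (n + 1).factorial * ((Z + 1) * 2 ^ n) with hC
  have hlim : Tendsto (fun X : ℝ => C * X ^ (-(η * n - 1))) atTop (nhds (C * 0)) :=
    (tendsto_rpow_neg_atTop hηn).const_mul C
  rw [mul_zero] at hlim
  filter_upwards [hlim.eventually (gt_mem_nhds one_pos), eventually_ge_atTop 1] with X hX hX1
  rintro ⟨v, hv, hsol⟩
  obtain ⟨c, hc⟩ := exists_det_submatrix_ne_zero hv
  have h1 : (1 : ℝ) ≤ |((Matrix.of fun a b => v a (c b)).det : ℤ)| := by
    exact_mod_cast Int.one_le_abs hc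
  have hδ : X ^ (-η) ≤ 1 := Real.rpow_le_one_of_one_le_of_nonpos hX1 (by linarith)
  have h2 := abs_det_le_of_near_rankOne (A := Matrix.of fun a b => ((v a (c b) : ℤ) : ℝ))
    (x := fun a => (v a 0 : ℝ)) (z := fun b => z (c b)) hX1 hδ (fun a => (hsol a).1)
    (fun b => hZ _) (fun a b => by
      rcases Fin.eq_zero_or_eq_succ (c b) with h | ⟨m, h⟩
      · simp only [Matrix.of_apply, h, z, Fin.cons_zero, mul_one, sub_self, abs_zero]
        positivity
      · simp only [Matrix.of_apply, h, z, Fin.cons_succ]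
        rw [mul_comm]
        exact (hsol a).2 m)
  have h3 : ((n + 1).factorial : ℝ) * (((Z + 1) * X) * (2 * X ^ (-η)) ^ n)
      = C * X ^ (-(η * n - 1)) := by
    have : X ^ (-(η * n - 1)) = X * (X ^ (-η)) ^ n := by
      rw [← Real.rpow_natCast, ← Real.rpow_mul (by linarith),
        show -(η * n - 1) = 1 + -η * n by ring, Real.rpow_add (by linarith), Real.rpow_one]
    rw [this, hC, mul_pow]; ring
  rw [h3] at h2
  rw [Int.cast_abs, Int.cast_det] at h1
  exact absurd (h1.trans (by simpa [Matrix.map] using! h2)) (not_le.2 hX)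

/-! ### Lower bounds for the uniform constants -/

/-- Dirichlet's theorem on simultaneous approximation. -/
theorem exists_simultaneous_approx {k : ℕ} (ζ : Fin k → ℝ) {N M : ℕ} (hN : 0 < N)
    (hM : N ^ k ≤ M) :
    ∃ (x : ℤ) (y : Fin k → ℤ), x ≠ 0 ∧ |(x : ℝ)| ≤ M ∧ ∀ m, |ζ m * x - y m| ≤ 1 / N := by
  have hNr : (0 : ℝ) < N := by exact_mod_cast hN
  have hlt : ∀ t : ℝ, ⌊(N : ℝ) * Int.fract t⌋₊ < N := fun t => by
    rw [Nat.floor_lt (by positivity)]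
    nlinarith [Int.fract_lt_one t]
  -- Pigeonhole: `M + 1` multiples of `ζ`, `N ^ k` boxes of side `1 / N`.
  let f : Fin (M + 1) → Fin k → Fin N := fun a m => ⟨_, hlt (ζ m * (a : ℕ))⟩
  obtain ⟨a, b, hab, hf⟩ := Fintype.exists_ne_map_eq_of_card_lt f (by simp; omega)
  refine ⟨(a : ℕ) - (b : ℕ), fun m => ⌊ζ m * (a : ℕ)⌋ - ⌊ζ m * (b : ℕ)⌋, ?_, ?_, fun m => ?_⟩
  · rw [sub_ne_zero]
    exact_mod_cast Fin.val_ne_of_ne hab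
  · have ha : ((a : ℕ) : ℝ) ≤ M := by exact_mod_cast Nat.lt_succ_iff.1 a.2
    have hb : ((b : ℕ) : ℝ) ≤ M := by exact_mod_cast Nat.lt_succ_iff.1 b.2
    push_cast
    rw [abs_le]
    constructor <;> linarith [Nat.cast_nonneg (α := ℝ) (a : ℕ), Nat.cast_nonneg (α := ℝ) (b : ℕ)]
  · have h := congrArg Fin.val (congrFun hf m)
    simp only [f] at h
    have key : ζ m * (((a : ℕ) - (b : ℕ) : ℤ) : ℝ)
        - ((⌊ζ m * (a : ℕ)⌋ - ⌊ζ m * (b : ℕ)⌋ : ℤ) : ℝ)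
        = Int.fract (ζ m * (a : ℕ)) - Int.fract (ζ m * (b : ℕ)) := by
      simp only [Int.fract]; push_cast; ring
    rw [key, le_div_iff₀ hNr]
    set s := Int.fract (ζ m * (a : ℕ))
    set t := Int.fract (ζ m * (b : ℕ))
    have hs : 0 ≤ (N : ℝ) * s := mul_nonneg hNr.le (Int.fract_nonneg _)
    have ht : 0 ≤ (N : ℝ) * t := mul_nonneg hNr.le (Int.fract_nonneg _)
    have h1 := Nat.floor_le hs
    have h2 := Nat.floor_le ht
    have h3 := Nat.lt_floor_add_one ((N : ℝ) * s)
    have h4 := Nat.lt_floor_add_one ((N : ℝ) * t)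
    rw [h] at h1 h3
    have h5 : |s - t| * N = |(s - t) * N| := by rw [abs_mul, abs_of_pos hNr]
    rw [h5, abs_le]
    constructor <;> linarith

theorem le_uniformApproxConst_one {k : ℕ} (hk : 1 ≤ k) (ζ : Fin k → ℝ) :
    ((1 / (k : ℝ) : ℝ) : EReal) ≤ uniformApproxConst ζ 1 := by
  refine le_sSup_coe_image fun η hη => ?_
  have hk0 : (0 : ℝ) < k := by exact_mod_cast hk
  -- The spare factor `X ^ (1 / k - η) ≥ 2` pays for rounding `X ^ (1 / k)` down to an integer.
  filter_upwards [(tendsto_rpow_atTop (sub_pos.2 hη)).eventually (eventually_ge_atTop 2),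
    (tendsto_rpow_atTop (one_div_pos.2 hk0)).eventually (eventually_ge_atTop 2),
    eventually_ge_atTop 1] with X h2 hY2 hX1
  have hX0 : 0 < X := by linarith
  set Y : ℝ := X ^ (1 / (k : ℝ)) with hY
  have hYk : Y ^ k = X := by
    rw [hY, ← Real.rpow_natCast, ← Real.rpow_mul hX0.le]
    field_simp
    exact Real.rpow_one X
  have hNY : (⌊Y⌋₊ : ℝ) ≤ Y := Nat.floor_le (by linarith)
  have hYN : Y / 2 ≤ (⌊Y⌋₊ : ℝ) := by linarith [Nat.lt_floor_add_one Y]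
  obtain ⟨x, y, hx0, hx, hy⟩ := exists_simultaneous_approx ζ (N := ⌊Y⌋₊) (M := ⌊X⌋₊)
    (Nat.floor_pos.2 (by linarith)) (Nat.le_floor (by
      push_cast
      rw [← hYk]
      exact pow_le_pow_left₀ (by positivity) hNY k))
  refine ⟨fun _ => Fin.cons x y, ?_, fun i => ⟨?_, fun m => ?_⟩⟩
  · rw [linearIndependent_unique_iff]
    exact fun h => hx0 (by simpa using congrFun h 0)
  · simpa using hx.trans (Nat.floor_le hX0.le)
  · simp only [Fin.cons_zero, Fin.cons_succ]
    refine (hy m).trans ?_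
    have h5 : 0 < X ^ η := Real.rpow_pos_of_pos hX0 _
    rw [Real.rpow_neg hX0.le, ← one_div]
    refine one_div_le_one_div_of_le h5 (le_trans ?_ hYN)
    have h6 : Y = X ^ (1 / (k : ℝ) - η) * X ^ η := by
      rw [← Real.rpow_add hX0, sub_add_cancel]
    nlinarith

theorem uniformApproxConst_nonneg {k : ℕ} {ζ : Fin k → ℝ} (hζ : ∀ m, |ζ m| ≤ 1) {j : ℕ}
    (hj : j ≤ k + 1) : 0 ≤ uniformApproxConst ζ j := by
  refine le_sSup ⟨0, ?_, rfl⟩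
  filter_upwards [eventually_ge_atTop 1] with X hX
  refine HasIndepSolutions.mono hj ⟨fun i => Pi.single i 1, ?_, fun i => ⟨?_, fun m => ?_⟩⟩
  · exact Pi.linearIndependent_single_one (Fin (k + 1)) ℤ
  · dsimp only
    by_cases hi : i = 0
    · subst hi; simpa using hX
    · rw [Pi.single_eq_of_ne (Ne.symm hi)]; simp; exact zero_le_one.trans hX
  · dsimp only
    rw [neg_zero, Real.rpow_zero]
    by_cases hi : i = 0
    · subst hi; simpa using hζ m
    · rw [Pi.single_eq_of_ne (Ne.symm hi)]
      by_cases hm : m.succ = i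
      · subst hm; simp
      · rw [Pi.single_eq_of_ne hm]; simp

/-! ### Partial sums of `L` -/

/-- The numerator of `∑ i ∈ [1, n], 10 ^ (-i!)` over the denominator `10 ^ n!`. -/
def liouvilleNumerator : ℕ → ℤ
  | 0 => 0
  | n + 1 => liouvilleNumerator n * 10 ^ ((n + 1).factorial - n.factorial) + 1

theorem liouvilleNumerator_nonneg (n : ℕ) : 0 ≤ liouvilleNumerator n := by
  induction n with
  | zero => exact le_rfl
  | succ n ih => rw [liouvilleNumerator]; positivity

theorem isCoprime_liouvilleNumerator {n : ℕ} (hn : 2 ≤ n) : IsCoprime (liouvilleNumerator n) 10 := by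
  obtain ⟨n, rfl⟩ : ∃ m, n = m + 1 := ⟨n - 1, by omega⟩
  have hlt : n.factorial < (n + 1).factorial := (Nat.factorial_lt (by omega)).2 (by omega)
  obtain ⟨e, he⟩ : ∃ e, (n + 1).factorial - n.factorial = e + 1 :=
    ⟨(n + 1).factorial - n.factorial - 1, by omega⟩
  exact ⟨1, -(liouvilleNumerator n * 10 ^ e), by rw [liouvilleNumerator, he]; ring⟩

theorem liouvilleNumerator_succ_div (n : ℕ) :
    (liouvilleNumerator (n + 1) : ℝ) / 10 ^ (n + 1).factorial
      = liouvilleNumerator n / 10 ^ n.factorial + 1 / 10 ^ (n + 1).factorial := by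
  have h : (10 : ℝ) ^ (n + 1).factorial
      = 10 ^ ((n + 1).factorial - n.factorial) * 10 ^ n.factorial := by
    rw [← pow_add, Nat.sub_add_cancel (Nat.factorial_le n.le_succ)]
  rw [liouvilleNumerator]
  push_cast
  rw [add_div, h, mul_comm, mul_div_mul_left _ _ (by positivity)]

theorem liouvilleL_sub_eq_remainder (n : ℕ) :
    liouvilleL - liouvilleNumerator n / 10 ^ n.factorial = LiouvilleNumber.remainder 10 n := by
  have h10 : (1 : ℝ) < 10 := by norm_num
  -- The `1 / 10` is the extra term `10 ^ (-0!)` in Mathlib's partial sums.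
  have h : ∀ n, (liouvilleNumerator n : ℝ) / 10 ^ n.factorial
      = LiouvilleNumber.partialSum 10 n - 1 / 10 := by
    intro n
    induction n with
    | zero => simp [liouvilleNumerator, LiouvilleNumber.partialSum]
    | succ n ih => rw [liouvilleNumerator_succ_div, ih, LiouvilleNumber.partialSum_succ]; ring
  have h0 : LiouvilleNumber.remainder 10 0 = liouvilleL := rfl
  have h1 := LiouvilleNumber.partialSum_add_remainder h10 0
  have h2 := LiouvilleNumber.partialSum_add_remainder h10 n
  have h3 := h 0
  simp only [liouvilleNumerator, Int.cast_zero, zero_div] at h3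
  rw [h n, ← h0]
  linarith

theorem liouvilleL_sub_nonneg (n : ℕ) :
    0 ≤ liouvilleL - liouvilleNumerator n / 10 ^ n.factorial := by
  rw [liouvilleL_sub_eq_remainder]
  exact (LiouvilleNumber.remainder_pos (by norm_num) n).le

theorem liouvilleL_sub_le (n : ℕ) :
    liouvilleL - liouvilleNumerator n / 10 ^ n.factorial ≤ 2 / 10 ^ (n + 1).factorial := by
  rw [liouvilleL_sub_eq_remainder]
  refine (LiouvilleNumber.remainder_lt' n (by norm_num)).le.trans ?_
  rw [mul_one_div]
  gcongr
  norm_num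

theorem liouvilleL_nonneg : 0 ≤ liouvilleL := by
  simpa [liouvilleNumerator] using liouvilleL_sub_nonneg 0

theorem liouvilleL_le_one : liouvilleL ≤ 1 := by
  have := liouvilleL_sub_le 0
  norm_num [liouvilleNumerator] at this
  linarith

theorem ten_pow_factorial_succ (n : ℕ) :
    (10 : ℝ) ^ (n + 1).factorial = (10 ^ n.factorial) ^ (n + 1) := by
  rw [← pow_mul, Nat.factorial_succ, mul_comm]

theorem ten_le_ten_pow_factorial (n : ℕ) : (10 : ℝ) ≤ 10 ^ n.factorial :=
  le_self_pow₀ (by norm_num) (Nat.factorial_ne_zero n)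

theorem tendsto_ten_pow_factorial :
    Tendsto (fun n : ℕ => (10 : ℝ) ^ n.factorial) atTop atTop :=
  tendsto_atTop_mono (fun n => pow_le_pow_right₀ (by norm_num) n.self_le_factorial)
    (tendsto_pow_atTop_atTop_of_one_lt (by norm_num : (1 : ℝ) < 10))

theorem powerVector_liouvilleL_abs_le_one (k : ℕ) (m : Fin k) :
    |powerVector k liouvilleL m| ≤ 1 := by
  rw [powerVector, abs_of_nonneg (pow_nonneg liouvilleL_nonneg _)]
  exact pow_le_one₀ liouvilleL_nonneg liouvilleL_le_one

/-! ### Upper bounds for the uniform constants -/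

/-- A good approximation to `(L, L ^ 2, …, L ^ k)` with small first coordinate is proportional to
`(1, p / q, …, (p / q) ^ k)`. -/
theorem mul_pow_eq_of_approx {k n : ℕ} {v : Fin (k + 1) → ℤ} {X δ : ℝ} (hδ0 : 0 ≤ δ)
    (hX : |(v 0 : ℝ)| ≤ X)
    (hδ : ∀ m, |powerVector k liouvilleL m * v 0 - v m.succ| ≤ δ)
    (hsmall : (10 : ℝ) ^ n.factorial * (2 / 10 ^ (n + 1).factorial * X + 2 * δ) < 1)
    (m : Fin (k + 1)) :
    (10 ^ n.factorial) ^ (m : ℕ) * v m = liouvilleNumerator n ^ (m : ℕ) * v 0 := by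
  set q : ℝ := 10 ^ n.factorial with hq
  have hq0 : 0 < q := by positivity
  set a : ℝ := liouvilleNumerator n / q with ha
  have ha0 : 0 ≤ a := div_nonneg (by exact_mod_cast liouvilleNumerator_nonneg n) hq0.le
  have hLa0 : 0 ≤ liouvilleL - a := liouvilleL_sub_nonneg n
  have hLa : liouvilleL - a ≤ 2 / 10 ^ (n + 1).factorial := liouvilleL_sub_le n
  have ha1 : a ≤ 1 := by linarith [liouvilleL_le_one]
  have happ : ∀ m : Fin (k + 1), |liouvilleL ^ (m : ℕ) * v 0 - v m| ≤ δ := by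
    intro m
    rcases Fin.eq_zero_or_eq_succ m with rfl | ⟨m, rfl⟩
    · simpa using hδ0
    · simpa [powerVector] using hδ m
  -- The difference of the two sides is an integer of absolute value below 1, hence zero.
  have step : ∀ m : Fin k,
      10 ^ n.factorial * v m.succ = liouvilleNumerator n * v m.castSucc := by
    intro m
    rw [← sub_eq_zero, ← Int.abs_lt_one_iff]
    have h1 := happ m.castSucc
    have h2 := happ m.succ
    simp only [Fin.val_castSucc, Fin.val_succ] at h1 h2
    have key : q * (v m.succ : ℝ) - liouvilleNumerator n * v m.castSucc
        = q * ((liouvilleL - a) * (liouvilleL ^ (m : ℕ) * v 0)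
          + (a * (liouvilleL ^ (m : ℕ) * v 0 - v m.castSucc)
          - (liouvilleL ^ ((m : ℕ) + 1) * v 0 - v m.succ))) := by
      have : (liouvilleNumerator n : ℝ) = q * a := by rw [ha]; field_simp
      rw [this]; ring
    have hlt : |q * (v m.succ : ℝ) - liouvilleNumerator n * v m.castSucc| < 1 := by
      refine lt_of_le_of_lt ?_ hsmall
      rw [key, abs_mul, abs_of_pos hq0]
      refine mul_le_mul_of_nonneg_left ?_ hq0.le
      refine (abs_add_le _ _).trans (add_le_add ?_ ((abs_sub _ _).trans ?_))
      · rw [abs_mul, abs_of_nonneg hLa0]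
        refine mul_le_mul hLa ?_ (abs_nonneg _) (by positivity)
        rw [abs_mul, abs_of_nonneg (pow_nonneg liouvilleL_nonneg _)]
        refine le_trans ?_ hX
        exact mul_le_of_le_one_left (abs_nonneg _)
          (pow_le_one₀ liouvilleL_nonneg liouvilleL_le_one)
      · rw [abs_mul, abs_of_nonneg ha0]
        have := mul_le_of_le_one_left (abs_nonneg (liouvilleL ^ (m : ℕ) * v 0 - v m.castSucc)) ha1
        linarith
    have : ((|10 ^ n.factorial * v m.succ - liouvilleNumerator n * v m.castSucc| : ℤ) : ℝ)
        < (1 : ℤ) := by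
      push_cast
      exact hlt
    exact_mod_cast this
  induction m using Fin.induction with
  | zero => simp
  | succ m ih =>
    rw [Fin.val_castSucc] at ih
    rw [Fin.val_succ, pow_succ, mul_assoc, step, pow_succ]
    linear_combination liouvilleNumerator n * ih

/-- Tested at `X = q ^ k / 2`: a solution has `q ^ k ∣ x`, so `x = 0`, and proportionality makes the
whole vector vanish. -/
theorem uniformApproxConst_one_liouvilleL_le {k : ℕ} (hk : 1 ≤ k) :
    powerUniformApproxConst k 1 liouvilleL ≤ ((1 / (k : ℝ) : ℝ) : EReal) := by
  refine uniformApproxConst_le fun η hη => ?_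
  have hk0 : (0 : ℝ) < k := by exact_mod_cast hk
  have hηk : 0 < k * η - 1 := by rw [div_lt_iff₀ hk0] at hη; linarith
  have hXlim : Tendsto (fun n : ℕ => ((10 : ℝ) ^ n.factorial) ^ k / 2) atTop atTop :=
    ((tendsto_pow_atTop (by omega)).comp tendsto_ten_pow_factorial).atTop_div_const two_pos
  refine hXlim.frequently (Eventually.frequently ?_)
  have hlim := ((tendsto_rpow_neg_atTop hηk).comp tendsto_ten_pow_factorial).const_mul
    (2 * 2 ^ η : ℝ)
  rw [mul_zero] at hlim
  filter_upwards [hlim.eventually (gt_mem_nhds (show (0 : ℝ) < 1 / 2 by norm_num)),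
    eventually_ge_atTop (k + 1)] with n hn hnk
  simp only [Function.comp_apply] at hn
  rintro ⟨v, hv, hsol⟩
  have hq10 := ten_le_ten_pow_factorial n
  have hv0 : v 0 ≠ 0 := hv.ne_zero 0
  obtain ⟨hx, hy⟩ := hsol 0
  have heq := mul_pow_eq_of_approx (n := n) (by positivity) hx hy (by
    rw [ten_pow_factorial_succ]
    set q : ℝ := 10 ^ n.factorial
    have hq0 : 0 < q := by linarith
    have h1 : q * (2 / q ^ (n + 1) * (q ^ k / 2)) ≤ 1 / q := by
      have : q ^ (k + 1 + 1) ≤ q ^ (n + 1) := pow_le_pow_right₀ (by linarith) (by omega)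
      rw [show q * (2 / q ^ (n + 1) * (q ^ k / 2)) = q ^ (k + 1) / q ^ (n + 1) by
        field_simp; ring, div_le_div_iff₀ (by positivity) hq0]
      rw [one_mul, ← pow_succ]
      exact this
    have h2 : q * (2 * (q ^ k / 2) ^ (-η)) = 2 * 2 ^ η * q ^ (-(k * η - 1)) := by
      rw [Real.div_rpow (by positivity) (by norm_num), Real.rpow_neg two_pos.le,
        ← Real.rpow_natCast, ← Real.rpow_mul hq0.le,
        show -((k : ℝ) * η - 1) = 1 + k * -η by ring, Real.rpow_add hq0, Real.rpow_one,
        div_inv_eq_mul]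
      ring
    have h3 : 1 / q ≤ 1 / 10 := one_div_le_one_div_of_le (by norm_num) hq10
    rw [mul_add, h2]
    linarith)
  have hcop : IsCoprime (((10 : ℤ) ^ n.factorial) ^ k) (liouvilleNumerator n ^ k) :=
    ((isCoprime_liouvilleNumerator (n := n) (by omega)).symm.pow_left.pow_left).pow_right
  have hdvd : ((10 : ℤ) ^ n.factorial) ^ k ∣ v 0 0 := by
    have h := heq (Fin.last k)
    rw [Fin.val_last] at h
    exact hcop.dvd_of_dvd_mul_left ⟨_, h.symm⟩
  have hx0 : v 0 0 = 0 := by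
    by_contra hne
    have h1 := Int.le_of_dvd (abs_pos.2 hne) ((dvd_abs _ _).2 hdvd)
    have h2 : ((10 : ℝ) ^ n.factorial) ^ k ≤ |(v 0 0 : ℝ)| := by exact_mod_cast h1
    have : 0 < ((10 : ℝ) ^ n.factorial) ^ k := by positivity
    linarith
  refine hv0 (funext fun m => ?_)
  have h := heq m
  rw [hx0, mul_zero] at h
  exact (mul_eq_zero.1 h).resolve_left (by positivity)

theorem uniformApproxConst_liouvilleL_nonpos (k : ℕ) {j : ℕ} (hj : 2 ≤ j) :
    powerUniformApproxConst k j liouvilleL ≤ 0 := by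
  rw [← EReal.coe_zero]
  refine uniformApproxConst_le fun η hη => ?_
  -- At `X = q ^ (n - 1)` the term `q * (2 / Q) * X` is still only `2 / q`, while `X ^ (-η) ≤ q ^
  -- (-2)` once `(n - 1) * η ≥ 2`.
  have hXlim : Tendsto (fun n : ℕ => ((10 : ℝ) ^ n.factorial) ^ (n - 1)) atTop atTop := by
    refine tendsto_atTop_mono' _ ?_ tendsto_ten_pow_factorial
    filter_upwards [eventually_ge_atTop 2] with n hn
    exact le_self_pow₀ (by linarith [ten_le_ten_pow_factorial n]) (by omega)
  refine hXlim.frequently (Eventually.frequently ?_)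
  have hlim : Tendsto (fun n : ℕ => (n : ℝ) * η) atTop atTop :=
    tendsto_natCast_atTop_atTop.atTop_mul_const hη
  filter_upwards [hlim.eventually (eventually_ge_atTop (2 + η)),
    eventually_ge_atTop 1] with n hn hn1
  intro hsol
  obtain ⟨v, hv, hsol⟩ := hsol.mono hj
  have hq10 := ten_le_ten_pow_factorial n
  have heq := fun i => mul_pow_eq_of_approx (n := n) (by positivity) (hsol i).1 (hsol i).2 (by
    rw [ten_pow_factorial_succ]
    obtain ⟨d, rfl⟩ : ∃ d, n = d + 1 := ⟨n - 1, by omega⟩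
    rw [Nat.add_sub_cancel]
    set q : ℝ := 10 ^ (d + 1).factorial
    have hq0 : 0 < q := by linarith
    have h1 : q * (2 / q ^ (d + 1 + 1) * q ^ d) = 2 * (1 / q) := by
      field_simp; ring
    have h2 : (q ^ d) ^ (-η) ≤ 1 / q * (1 / q) := by
      have : 1 / q * (1 / q) = q ^ (-2 : ℝ) := by
        rw [Real.rpow_neg hq0.le, ← Nat.cast_two, Real.rpow_natCast]
        field_simp
      rw [this, ← Real.rpow_natCast, ← Real.rpow_mul hq0.le]
      refine Real.rpow_le_rpow_of_exponent_le (by linarith) ?_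
      push_cast at hn
      linarith
    have h3 : 1 / q ≤ 1 / 10 := one_div_le_one_div_of_le (by norm_num) hq10
    have h4 : q * (2 * (q ^ d) ^ (-η)) ≤ 2 * (1 / q) := by
      calc q * (2 * (q ^ d) ^ (-η)) ≤ q * (2 * (1 / q * (1 / q))) := by gcongr
        _ = 2 * (1 / q) := by field_simp
    rw [mul_add, h1]
    linarith)
  have hrel : v 1 0 • v 0 + (-(v 0 0)) • v 1 = 0 := by
    funext m
    have h0 := heq 0 m
    have h1 := heq 1 m
    have hne : ((10 : ℤ) ^ n.factorial) ^ (m : ℕ) ≠ 0 := by positivity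
    apply mul_left_cancel₀ hne
    simp only [Pi.add_apply, Pi.smul_apply, smul_eq_mul, Pi.zero_apply, mul_zero]
    linear_combination v 1 0 * h0 - v 0 0 * h1
  have hpair : LinearIndependent ℤ ![v 0, v 1] := by
    convert hv using 1
    ext i; fin_cases i <;> rfl
  obtain ⟨-, h0⟩ := LinearIndependent.pair_iff.1 hpair _ _ hrel
  refine hv.ne_zero 0 (funext fun m => ?_)
  have h := heq 0 m
  rw [neg_eq_zero.1 h0, mul_zero] at h
  exact (mul_eq_zero.1 h).resolve_left (by positivity)

/-! ### Lower bounds for the ordinary constants by truncated expansions -/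

/-- Truncation of the binomial expansion of `(a + h) ^ m` after the power `h ^ i`. -/
theorem abs_add_pow_sub_sum_range_le {a h : ℝ} (ha0 : 0 ≤ a) (ha1 : a ≤ 1) (hh0 : 0 ≤ h)
    (hh1 : h ≤ 1) (m i : ℕ) :
    |(a + h) ^ m - ∑ l ∈ Finset.range (i + 1), h ^ l * a ^ (m - l) * (m.choose l : ℝ)|
      ≤ (m + 1) * 2 ^ m * h ^ (i + 1) := by
  -- Padding with zero binomials avoids comparing `i` with `m` and leaves a tail of `m + 1` terms.
  have hext : (a + h) ^ m
      = ∑ l ∈ Finset.range (i + 1 + (m + 1)), h ^ l * a ^ (m - l) * (m.choose l : ℝ) := by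
    rw [add_comm a h, add_pow]
    refine Finset.sum_subset (Finset.range_subset_range.2 (by omega)) fun l _ hl => ?_
    rw [Nat.choose_eq_zero_of_lt (by simpa using hl), Nat.cast_zero, mul_zero]
  rw [hext, Finset.sum_range_add, add_sub_cancel_left, abs_of_nonneg (by positivity)]
  refine (Finset.sum_le_card_nsmul _ _ (2 ^ m * h ^ (i + 1)) fun l _ => ?_).trans
    (le_of_eq (by simp; ring))
  have h1 : h ^ (i + 1 + l) ≤ h ^ (i + 1) := pow_le_pow_of_le_one hh0 hh1 (by omega)
  have h2 : a ^ (m - (i + 1 + l)) ≤ 1 := pow_le_one₀ ha0 ha1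
  have h3 : (m.choose (i + 1 + l) : ℝ) ≤ 2 ^ m := by exact_mod_cast Nat.choose_le_two_pow _ _
  calc h ^ (i + 1 + l) * a ^ (m - (i + 1 + l)) * (m.choose (i + 1 + l) : ℝ)
      ≤ h ^ (i + 1) * 1 * 2 ^ m := by gcongr
    _ = 2 ^ m * h ^ (i + 1) := by ring

/-- The integer vector `q ^ k * Q ^ i * ∑ l ≤ i, (m choose l) * (p / q) ^ (m - l) * Q ^ (-l)`
(`0 ≤ m ≤ k`), which approximates `q ^ k * Q ^ i * (p / q + 1 / Q) ^ m`. -/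
def truncatedPowerVector (k : ℕ) (p q Q : ℤ) (i : ℕ) (m : Fin (k + 1)) : ℤ :=
  ∑ l ∈ Finset.range (i + 1),
    Q ^ (i - l) * ((m : ℕ).choose l * p ^ ((m : ℕ) - l) * q ^ (k - ((m : ℕ) - l)))

theorem truncatedPowerVector_zero (k : ℕ) (p q Q : ℤ) (i : ℕ) :
    truncatedPowerVector k p q Q i 0 = q ^ k * Q ^ i := by
  rw [truncatedPowerVector, Finset.sum_eq_single 0]
  · simp [mul_comm]
  · intro l _ hl
    simp [Nat.choose_eq_zero_of_lt (Nat.pos_of_ne_zero hl)]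
  · simp

theorem cast_truncatedPowerVector {k : ℕ} {p q Q : ℤ} (hq : q ≠ 0) (hQ : Q ≠ 0) (i : ℕ)
    (m : Fin (k + 1)) :
    (truncatedPowerVector k p q Q i m : ℝ) = (q : ℝ) ^ k * (Q : ℝ) ^ i *
      ∑ l ∈ Finset.range (i + 1),
        (1 / (Q : ℝ)) ^ l * ((p : ℝ) / q) ^ ((m : ℕ) - l) * ((m : ℕ).choose l : ℝ) := by
  have hq' : (q : ℝ) ≠ 0 := by exact_mod_cast hq
  have hQ' : (Q : ℝ) ≠ 0 := by exact_mod_cast hQ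
  rw [truncatedPowerVector, Finset.mul_sum]
  push_cast
  refine Finset.sum_congr rfl fun l hl => ?_
  have hli : l ≤ i := Nat.lt_succ_iff.1 (Finset.mem_range.1 hl)
  rw [pow_sub₀ _ hQ' hli, pow_sub₀ _ hq' (show (m : ℕ) - l ≤ k by omega), div_pow, div_pow]
  field_simp
  simp

/-- The first `j` coordinates form a product of a unipotent lower triangular matrix in `Q` and an
upper triangular one with diagonal `q ^ k`. -/
theorem linearIndependent_truncatedPowerVector {k j : ℕ} {p q Q : ℤ} (hq : q ≠ 0)
    (hj : j ≤ k + 1) :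
    LinearIndependent ℤ fun i : Fin j => truncatedPowerVector k p q Q (i : ℕ) := by
  let A : Matrix (Fin j) (Fin j) ℤ := Matrix.of fun i l =>
    if l ≤ i then Q ^ ((i : ℕ) - (l : ℕ)) else 0
  let W : Matrix (Fin j) (Fin j) ℤ := Matrix.of fun l m =>
    ((m : ℕ).choose l : ℤ) * p ^ ((m : ℕ) - (l : ℕ)) * q ^ (k - ((m : ℕ) - (l : ℕ)))
  have hA : A.det = 1 := by
    rw [Matrix.det_of_isLowerTriangular A (fun i l hil => by
      simp only [A, Matrix.of_apply]
      exact if_neg (not_le.2 hil))]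
    simp [A]
  have hW : W.det ≠ 0 := by
    rw [Matrix.det_of_isUpperTriangular (M := W) (fun l m hml => by
      simp only [W, Matrix.of_apply]
      rw [Nat.choose_eq_zero_of_lt (show (m : ℕ) < l from hml)]
      simp)]
    simp [W, hq]
  have hAW : (A * W).det ≠ 0 := by rw [Matrix.det_mul, hA, one_mul]; exact hW
  refine LinearIndependent.of_comp (LinearMap.funLeft ℤ ℤ (Fin.castLE hj)) ?_
  have heq : (LinearMap.funLeft ℤ ℤ (Fin.castLE hj) ∘
      fun i : Fin j => truncatedPowerVector k p q Q (i : ℕ)) = fun i => (A * W) i := ?_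
  · rw [heq]
    exact Matrix.linearIndependent_rows_of_det_ne_zero hAW
  funext i m
  simp only [Function.comp_apply, LinearMap.funLeft_apply, truncatedPowerVector, Matrix.mul_apply,
    A, W, Matrix.of_apply, Fin.val_castLE, ite_mul, zero_mul]
  rw [← Finset.sum_filter]
  refine Finset.sum_bij' (i := fun l hl => ⟨l, by have := Finset.mem_range.1 hl; omega⟩)
    (j := fun l _ => (l : ℕ)) ?_ ?_ ?_ ?_ ?_
  · intro l hl
    simp only [Finset.mem_filter, Finset.mem_univ, true_and, Fin.le_def]
    exact Nat.lt_succ_iff.1 (Finset.mem_range.1 hl)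
  · intro l hl
    simp only [Finset.mem_filter, Finset.mem_univ, true_and, Fin.le_def] at hl
    exact Finset.mem_range.2 (Nat.lt_succ_iff.2 hl)
  · intros; rfl
  · intros; rfl
  · intros; rfl

/-- The vectors `truncatedPowerVector` for two consecutive convergents of `L` approximate
`L ^ m`. -/
theorem abs_liouvilleL_pow_mul_sub_le {k n i : ℕ} (hkn : k ≤ n) (hik : i ≤ k) (m : Fin (k + 1)) :
    |liouvilleL ^ (m : ℕ) * (((10 : ℝ) ^ n.factorial) ^ k * (10 ^ (n + 1).factorial) ^ i)
      - truncatedPowerVector k (liouvilleNumerator n) (10 ^ n.factorial)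
          (10 ^ (n + 1).factorial) i m|
      ≤ (2 * k + (k + 1) * 2 ^ k) * ((10 ^ n.factorial) ^ k / 10 ^ (n + 1).factorial) := by
  rw [cast_truncatedPowerVector (by positivity) (by positivity)]
  push_cast
  have hsucc := liouvilleNumerator_succ_div n
  have h0 := liouvilleL_sub_nonneg (n + 1)
  have h1 := liouvilleL_sub_le (n + 1)
  have ha0 : (0 : ℝ) ≤ liouvilleNumerator n / 10 ^ n.factorial :=
    div_nonneg (by exact_mod_cast liouvilleNumerator_nonneg n) (by positivity)
  have ha1 : (liouvilleNumerator n : ℝ) / 10 ^ n.factorial ≤ 1 := by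
    linarith [liouvilleL_sub_nonneg n, liouvilleL_le_one]
  rw [hsucc] at h0 h1
  rw [ten_pow_factorial_succ (n + 1)] at h1
  have hQ10 := ten_le_ten_pow_factorial (n + 1)
  set q : ℝ := 10 ^ n.factorial
  set Q : ℝ := 10 ^ (n + 1).factorial
  set a : ℝ := liouvilleNumerator n / q
  have hq0 : 0 < q := by positivity
  have hQ0 : 0 < Q := by positivity
  have hh1 : 1 / Q ≤ 1 := by rw [div_le_one hQ0]; linarith
  have hb0 : 0 ≤ a + 1 / Q := by positivity
  have hb1 : a + 1 / Q ≤ 1 := by linarith [liouvilleL_le_one]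
  have hmk : ((m : ℕ) : ℝ) ≤ k := by exact_mod_cast Nat.lt_succ_iff.1 m.2
  have e1 : |liouvilleL ^ (m : ℕ) - (a + 1 / Q) ^ (m : ℕ)| ≤ 2 * k / Q ^ (i + 1) := by
    refine (abs_pow_sub_pow_le _ _ _).trans ?_
    rw [abs_of_nonneg h0, abs_of_nonneg hb0, abs_of_nonneg liouvilleL_nonneg]
    have hpow : max liouvilleL (a + 1 / Q) ^ ((m : ℕ) - 1) ≤ 1 :=
      pow_le_one₀ (le_max_of_le_right hb0) (max_le liouvilleL_le_one hb1)
    calc (liouvilleL - (a + 1 / Q)) * (m : ℕ) * max liouvilleL (a + 1 / Q) ^ ((m : ℕ) - 1)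
        ≤ (2 / Q ^ (n + 1 + 1)) * k * 1 := by gcongr
      _ = 2 * k / Q ^ (n + 1 + 1) := by ring
      -- Since `i ≤ k ≤ n`, the tail of `L` is no larger in order than the truncation error.
      _ ≤ 2 * k / Q ^ (i + 1) := by
        gcongr
        · linarith
        · omega
  have e2 := abs_add_pow_sub_sum_range_le ha0 ha1 (by positivity) hh1 (m : ℕ) i
  set S := ∑ l ∈ Finset.range (i + 1), (1 / Q) ^ l * a ^ ((m : ℕ) - l) * ((m : ℕ).choose l : ℝ)
  have e3 : (((m : ℕ) : ℝ) + 1) * 2 ^ (m : ℕ) * (1 / Q) ^ (i + 1)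
      ≤ (k + 1) * 2 ^ k / Q ^ (i + 1) := by
    rw [one_div, inv_pow, ← div_eq_mul_inv]
    gcongr
    · norm_num
    · exact Nat.lt_succ_iff.1 m.2
  have e4 : |liouvilleL ^ (m : ℕ) - S| ≤ (2 * k + (k + 1) * 2 ^ k) / Q ^ (i + 1) := by
    rw [add_div]
    exact (abs_sub_le _ ((a + 1 / Q) ^ (m : ℕ)) _).trans (add_le_add e1 (e2.trans e3))
  rw [mul_comm (liouvilleL ^ (m : ℕ)), ← mul_sub, abs_mul, abs_of_pos (by positivity)]
  refine (mul_le_mul_of_nonneg_left e4 (by positivity)).trans (le_of_eq ?_)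
  field_simp; ring

theorem frequently_hasIndepSolutions_liouvilleL {k n : ℕ} (hk : 1 ≤ k) (hnk : n ≤ k) {η : ℝ}
    (hη : η * n < 1) :
    ∃ᶠ X : ℝ in atTop, HasIndepSolutions (powerVector k liouvilleL) (n + 1) η X := by
  have hXlim : Tendsto (fun s : ℕ => ((10 : ℝ) ^ s.factorial) ^ k
      * (10 ^ (s + 1).factorial) ^ n) atTop atTop := by
    refine tendsto_atTop_mono (fun s => ?_) tendsto_ten_pow_factorial
    have h1 : (1 : ℝ) ≤ (10 ^ (s + 1).factorial) ^ n := one_le_pow₀ (one_le_pow₀ (by norm_num))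
    have h2 : (10 : ℝ) ^ s.factorial ≤ (10 ^ s.factorial) ^ k :=
      le_self_pow₀ (one_le_pow₀ (by norm_num)) (by omega)
    exact h2.trans (le_mul_of_one_le_right (by positivity) h1)
  refine hXlim.frequently (Eventually.frequently ?_)
  have hlim : Tendsto (fun s : ℕ => (s : ℝ) * (1 - η * n)) atTop atTop :=
    tendsto_natCast_atTop_atTop.atTop_mul_const (by linarith)
  -- The first condition is `k - s ≤ -η * (k + (s + 1) * n)`, the comparison of exponents of `q`;
  -- the second lets one factor `q` absorb the constant.
  filter_upwards [hlim.eventually (eventually_ge_atTop (k + η * k + η * n)),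
    tendsto_ten_pow_factorial.eventually (eventually_ge_atTop (2 * k + (k + 1) * 2 ^ k : ℝ)),
    eventually_ge_atTop k] with s hs hC hsk
  refine ⟨fun i => truncatedPowerVector k (liouvilleNumerator s) (10 ^ s.factorial)
    (10 ^ (s + 1).factorial) (i : ℕ), linearIndependent_truncatedPowerVector (by positivity)
    (by omega), fun i => ⟨?_, fun m => ?_⟩⟩
  · simp only [truncatedPowerVector_zero]
    push_cast
    rw [abs_of_nonneg (by positivity)]
    gcongr
    · exact one_le_pow₀ (by norm_num)
    · omega
  · have h := abs_liouvilleL_pow_mul_sub_le (i := i) hsk (by omega) m.succ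
    simp only [truncatedPowerVector_zero, powerVector]
    rw [Fin.val_succ] at h
    push_cast
    refine h.trans ?_
    rw [ten_pow_factorial_succ]
    have hq10 := ten_le_ten_pow_factorial s
    set q : ℝ := 10 ^ s.factorial
    have hq0 : 0 < q := by linarith
    have e1 : (2 * k + (k + 1) * 2 ^ k) * (q ^ k / q ^ (s + 1)) ≤ q ^ ((k : ℝ) - s) := by
      have : q ^ ((k : ℝ) - s) = q * (q ^ k / q ^ (s + 1)) := by
        rw [Real.rpow_sub hq0, Real.rpow_natCast, Real.rpow_natCast]
        field_simp; ring
      rw [this]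
      gcongr
    refine e1.trans ?_
    rw [← pow_mul q, ← pow_add, ← Real.rpow_natCast, ← Real.rpow_mul hq0.le]
    refine Real.rpow_le_rpow_of_exponent_le (by linarith) ?_
    push_cast
    nlinarith

theorem mainTheorem6 (k : ℕ) (hk : 1 ≤ k) :
    powerApproxConst k 1 liouvilleL = ⊤ ∧
    (∀ j : ℕ, 2 ≤ j → j ≤ k + 1 →
      powerApproxConst k j liouvilleL = ((1 / ((j : ℝ) - 1) : ℝ) : EReal)) ∧
    powerUniformApproxConst k 1 liouvilleL = ((1 / (k : ℝ) : ℝ) : EReal) ∧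
    (∀ j : ℕ, 2 ≤ j → j ≤ k + 1 → powerUniformApproxConst k j liouvilleL = 0) := by
  refine ⟨?_, fun j hj hjk => ?_, ?_, fun j hj hjk => ?_⟩
  · refine EReal.eq_top_iff_forall_lt _ |>.2 fun a => ?_
    refine (EReal.coe_lt_coe_iff.2 (lt_add_one a)).trans_le (le_sSup ⟨a + 1, ?_, rfl⟩)
    exact frequently_hasIndepSolutions_liouvilleL hk (Nat.zero_le k) (by simp)
  · obtain ⟨n, rfl⟩ : ∃ n, j = n + 1 := ⟨j - 1, by omega⟩
    have hn0 : (0 : ℝ) < n := by exact_mod_cast (show 0 < n by omega)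
    rw [Nat.cast_succ, add_sub_cancel_right]
    refine le_antisymm (approxConst_succ_le _ (by omega)) (le_sSup_coe_image fun η hη => ?_)
    exact frequently_hasIndepSolutions_liouvilleL hk (by omega) ((lt_div_iff₀ hn0).1 hη)
  · exact le_antisymm (uniformApproxConst_one_liouvilleL_le hk) (le_uniformApproxConst_one hk _)
  · exact le_antisymm (uniformApproxConst_liouvilleL_nonpos k hj)
      (uniformApproxConst_nonneg (powerVector_liouvilleL_abs_le_one k) hjk)
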